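/- For integers $n,m\ge 0$ let $$\operatorname{Sing}_{n,m}=\Bigl\{(A_1,\dots,A_m)\in(\mathbb C^{n\times n})^m \;:\; \det\Bigl(\sum_{k=1}^m\lambda_kA_k\Bigr)=0\text{ for all }\lambda\in\mathbb Q^m\Bigr\},$$ and let $I_{n,m}\subseteq\mathbb C[x_{ij}^{(k)} : 1\le i,j\le n,\ 1\le k\le m]$ be the ideal of all polynomials vanishing on $\operatorname{Sing}_{n,m}$. Say that an ideal $I$ of a polynomial ring is generated in degree at most $d$ if $I$ is generated, as an ideal, by its homogeneous elements of degree at most $d$. Let $n,d\ge 0$ be integers. Then the ideals $I_{n,m}$ are generated in degree at most $d$ for all $m\ge 0$ if and only if $I_{n,n^2}$ is generated in degree at most $d$. Moreover, the generation degree is constant from $m=n^2$ on: for every $m\ge n^2$, the ideal $I_{n,m}$ is generated in degree at most $d$ if and only if $I_{n,n^2}$ is. -/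

import Mathlib

/-- `Sing_{n,m}`: the `m`-tuples of complex `n × n` matrices all of whose rational linear
combinations are singular. -/
def Sing (n m : ℕ) : Set (Fin m → Matrix (Fin n) (Fin n) ℂ) :=
  {A | ∀ c : Fin m → ℚ, (∑ k, (c k : ℂ) • A k).det = 0}

/-- Indices of the coordinates `x_{ij}^{(k)}`, written as `(k, i, j)`. -/
abbrev TensorIndex (n m : ℕ) : Type := Fin m × Fin n × Fin n

/-- The tuple of matrices with entries `x_{ij}^{(k)} = x (k, i, j)`. -/
def slices {n m : ℕ} (x : TensorIndex n m → ℂ) : Fin m → Matrix (Fin n) (Fin n) ℂ :=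
  fun k => Matrix.of fun i j => x (k, i, j)

/-- `I_{n,m}`: the ideal of all polynomials over `ℂ` in the `m n²` variables `x_{ij}^{(k)}`
that vanish at every point of `Sing_{n,m}`. -/
noncomputable def singIdeal (n m : ℕ) : Ideal (MvPolynomial (TensorIndex n m) ℂ) :=
  MvPolynomial.vanishingIdeal ℂ {x : TensorIndex n m → ℂ | slices x ∈ Sing n m}

/-- An ideal of a polynomial ring is generated in degree at most `d` if it is the ideal
generated by its homogeneous elements of degree at most `d`. -/
def IsGeneratedInDegreeLE {σ R : Type*} [CommSemiring R] (I : Ideal (MvPolynomial σ R))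
    (d : ℕ) : Prop :=
  Ideal.span {f | f ∈ I ∧ ∃ e ≤ d, f.IsHomogeneous e} = I

/-! Substituting `P * R` for the copy index, with `P : m × m'` and `R : m' × m`, carries `I_{n,m}`
to itself by way of `I_{n,m'}`. So once `I_{n,m'}` is generated in degree `≤ d`, every element of
`I_{n,m}` in the span of its own substitutions by such products lies in the ideal generated in
degree `≤ d`. By Weyl's polarization theorem this is every element if `m'` is at least `m` or the
dimension `n²` of a slice. Polarization itself follows from a Hermitian form on polynomials for
which substitution by `S` and by `Sᴴ` are adjoint: the part of `f` orthogonal to all substitutions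
of `f` is killed by every such substitution, hence vanishes at every point. -/

open MvPolynomial Matrix
open scoped ComplexConjugate Kronecker Nat

section LinSubst

variable {R σ τ υ : Type*} [CommSemiring R]

theorem pderiv_bind₁ [Fintype σ] (g : σ → MvPolynomial τ R) (j : τ) (f : MvPolynomial σ R) :
    pderiv j (bind₁ g f) = ∑ i, bind₁ g (pderiv i f) * pderiv j (g i) := by
  classical
  induction f using MvPolynomial.induction_on with
  | C a => simp
  | add p q hp hq => simp only [map_add, hp, hq, add_mul, Finset.sum_add_distrib]
  | mul_X p k hp =>
    simp only [map_mul, bind₁_X_right, Derivation.leibniz, smul_eq_mul, hp, map_add, add_mul,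
      Finset.sum_add_distrib, Finset.mul_sum, pderiv_X, mul_assoc]
    simp [Pi.single_apply, apply_ite (bind₁ g)]

variable [Fintype τ] [Fintype υ]

/-- The linear substitution `x_i ↦ ∑ j, S i j * x_j`, that is, composition of polynomial functions
with the linear map given by `S`. -/
noncomputable def linSubst (S : Matrix σ τ R) : MvPolynomial σ R →ₐ[R] MvPolynomial τ R :=
  bind₁ S.toMvPolynomial

theorem linSubst_X (S : Matrix σ τ R) (i : σ) : linSubst S (X i) = ∑ j, C (S i j) * X j := by
  simp only [linSubst, bind₁_X_right, toMvPolynomial, C_mul_X_eq_monomial]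

theorem eval_linSubst (S : Matrix σ τ R) (y : τ → R) (f : MvPolynomial σ R) :
    eval y (linSubst S f) = eval (S *ᵥ y) f := by
  rw [linSubst, eval, eval₂Hom_bind₁]
  exact congrArg (fun x => eval x f) (funext fun i => toMvPolynomial_eval_eq_apply S i y)

theorem linSubst_linSubst (S : Matrix σ τ R) (T : Matrix τ υ R) (f : MvPolynomial σ R) :
    linSubst T (linSubst S f) = linSubst (S * T) f := by
  simp only [linSubst, bind₁_bind₁, ← toMvPolynomial_mul]

theorem isHomogeneous_linSubst (S : Matrix σ τ R) {f : MvPolynomial σ R} {e : ℕ}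
    (hf : f.IsHomogeneous e) : (linSubst S f).IsHomogeneous e := by
  rw [← one_mul e]
  exact hf.aeval S.toMvPolynomial S.toMvPolynomial_isHomogeneous

theorem totalDegree_linSubst_le (S : Matrix σ τ R) (f : MvPolynomial σ R) :
    (linSubst S f).totalDegree ≤ f.totalDegree := by
  conv_lhs => rw [← sum_homogeneousComponent f, map_sum]
  refine totalDegree_finsetSum_le fun e he => ?_
  exact (isHomogeneous_linSubst S (homogeneousComponent_isHomogeneous e f)).totalDegree_le.trans
    (Finset.mem_range_succ_iff.mp he)

theorem constantCoeff_linSubst (S : Matrix σ τ R) (f : MvPolynomial σ R) :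
    constantCoeff (linSubst S f) = constantCoeff f := by
  simp only [← eval_zero, eval_linSubst, mulVec_zero]

theorem pderiv_linSubst [Fintype σ] (S : Matrix σ τ R) (j : τ) (f : MvPolynomial σ R) :
    pderiv j (linSubst S f) = ∑ i, S i j • linSubst S (pderiv i f) := by
  classical
  have hX (i : σ) : pderiv j (S.toMvPolynomial i) = C (S i j) := by
    simp [toMvPolynomial, ← C_mul_X_eq_monomial, pderiv_X, Pi.single_apply]
  simp only [linSubst, pderiv_bind₁, hX, smul_eq_C_mul, mul_comm]

/-- The span of the polynomials obtained from `f` by the linear substitutions in `T`. -/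
noncomputable def substSpan (T : Set (Matrix σ τ R)) (f : MvPolynomial σ R) :
    Submodule R (MvPolynomial τ R) :=
  Submodule.span R ((linSubst · f) '' T)

theorem linSubst_mem_substSpan {T : Set (Matrix σ τ R)} {S : Matrix σ τ R} (hS : S ∈ T)
    (f : MvPolynomial σ R) : linSubst S f ∈ substSpan T f :=
  Submodule.subset_span (Set.mem_image_of_mem _ hS)

theorem linSubst_mem_substSpan_of_mem {T : Subsemigroup (Matrix τ τ R)} {S : Matrix τ τ R}
    (hS : S ∈ T) {f u : MvPolynomial τ R} (hu : u ∈ substSpan (T : Set (Matrix τ τ R)) f) :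
    linSubst S u ∈ substSpan (T : Set (Matrix τ τ R)) f := by
  induction hu using Submodule.span_induction with
  | mem _ hv =>
    obtain ⟨S', hS', rfl⟩ := hv
    rw [linSubst_linSubst]
    exact linSubst_mem_substSpan (T.mul_mem hS' hS) f
  | zero => rw [map_zero]; exact Submodule.zero_mem _
  | add v w _ _ hv hw => rw [map_add]; exact Submodule.add_mem _ hv hw
  | smul c v _ hv => rw [map_smul]; exact Submodule.smul_mem _ c hv

end LinSubst

section FischerForm

variable {R σ τ : Type*} [CommSemiring R]

theorem prod_factorial_add_single (α : σ →₀ ℕ) (i : σ) :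
    ((α + Finsupp.single i 1).prod fun _ k => (k ! : R)) =
      (α i + 1) * α.prod fun _ k => (k ! : R) := by
  classical
  have h (β : σ →₀ ℕ) := Finsupp.mul_prod_erase' β i (fun _ k => (k ! : R)) (by simp)
  rw [← h (α + Finsupp.single i 1), ← h α]
  simp [Nat.factorial_succ, mul_assoc]

variable [StarRing R]

/-- The Fischer form `⟨f, g⟩ = ∑ α, α! * conj (f_α) * g_α` on polynomials, where
`α! = ∏ i, (α i)!`. The factorials make multiplication by `X i` adjoint to `∂/∂X i`. -/
noncomputable def fischerForm : MvPolynomial σ R →ₗ⋆[R] MvPolynomial σ R →ₗ[R] R :=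
  LinearMap.mk₂'ₛₗ (starRingEnd R) (.id R)
    (fun f g => (AddMonoidAlgebra.coeff f).sum fun α a =>
      (α.prod fun _ k => (k ! : R)) * (conj a * coeff α g))
    (fun f₁ f₂ g => by
      rw [AddMonoidAlgebra.coeff_add]
      exact Finsupp.sum_add_index' (by simp) (by simp [add_mul, mul_add]))
    (fun c f g => by
      rw [AddMonoidAlgebra.coeff_smul, Finsupp.sum_smul_index' (by simp)]
      simp [Finsupp.mul_sum, mul_assoc, mul_left_comm])
    (fun f g₁ g₂ => by simp [mul_add])
    (fun c f g => by simp [Finsupp.mul_sum, mul_left_comm])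

theorem fischerForm_monomial_left (α : σ →₀ ℕ) (a : R) (g : MvPolynomial σ R) :
    fischerForm (monomial α a) g = (α.prod fun _ k => (k ! : R)) * (conj a * coeff α g) := by
  rw [fischerForm, LinearMap.mk₂'ₛₗ_apply, sum_monomial_eq (by simp)]

theorem fischerForm_C_left (a : R) (g : MvPolynomial σ R) :
    fischerForm (C a) g = conj a * constantCoeff g := by
  rw [← monomial_zero', fischerForm_monomial_left, Finsupp.prod_zero_index, one_mul,
    constantCoeff_eq]

theorem conj_fischerForm (f g : MvPolynomial σ R) : conj (fischerForm g f) = fischerForm f g := by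
  classical
  induction f using MvPolynomial.induction_on' with
  | add p q hp hq => rw [map_add, map_add, map_add, LinearMap.add_apply, hp, hq]
  | monomial α a =>
    induction g using MvPolynomial.induction_on' with
    | add p q hp hq => rw [map_add, map_add, LinearMap.add_apply, map_add, hp, hq]
    | monomial β b =>
      rcases eq_or_ne α β with rfl | h
      · simp [fischerForm_monomial_left, Finsupp.prod, mul_comm (conj a)]
      · simp [fischerForm_monomial_left, coeff_monomial, h, h.symm]

theorem fischerForm_mul_X_left (f g : MvPolynomial σ R) (i : σ) :
    fischerForm (f * X i) g = fischerForm f (pderiv i g) := by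
  induction f using MvPolynomial.induction_on' with
  | add p q hp hq =>
    rw [add_mul, map_add, map_add, LinearMap.add_apply, LinearMap.add_apply, hp, hq]
  | monomial α a =>
    rw [X, monomial_mul, mul_one, fischerForm_monomial_left, fischerForm_monomial_left,
      coeff_pderiv, prod_factorial_add_single]
    ring

theorem fischerForm_linSubst_left [Fintype σ] [Fintype τ] (S : Matrix σ τ R)
    (f : MvPolynomial σ R) (g : MvPolynomial τ R) :
    fischerForm (linSubst S f) g = fischerForm f (linSubst Sᴴ g) := by
  induction f using MvPolynomial.induction_on generalizing g with
  | C a => rw [linSubst, bind₁_C_right, fischerForm_C_left, fischerForm_C_left,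
      constantCoeff_linSubst]
  | add p q hp hq =>
    rw [map_add, map_add, map_add, LinearMap.add_apply, LinearMap.add_apply, hp, hq]
  | mul_X p i hp =>
    calc fischerForm (linSubst S (p * X i)) g
      _ = ∑ j, conj (S i j) * fischerForm (linSubst S p * X j) g := by
        simp only [map_mul, linSubst_X, ← smul_eq_C_mul, Finset.mul_sum, mul_smul_comm, map_sum,
          LinearMap.sum_apply, map_smulₛₗ, LinearMap.smul_apply, smul_eq_mul]
      _ = ∑ j, conj (S i j) * fischerForm p (linSubst Sᴴ (pderiv j g)) := by
        simp only [fischerForm_mul_X_left, hp]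
      _ = fischerForm (p * X i) (linSubst Sᴴ g) := by
        simp only [fischerForm_mul_X_left, pderiv_linSubst, map_sum, map_smul, smul_eq_mul,
          conjTranspose_apply, starRingEnd_apply]

end FischerForm

section Orbit

variable {𝕜 σ : Type*} [RCLike 𝕜]

theorem fischerForm_self (f : MvPolynomial σ 𝕜) :
    fischerForm f f =
      ((∑ α ∈ f.support, (α.prod fun _ k => (k ! : ℝ)) * ‖coeff α f‖ ^ 2 : ℝ) : 𝕜) := by
  rw [fischerForm, LinearMap.mk₂'ₛₗ_apply, sum_def]
  simp [RCLike.conj_mul, Finsupp.prod]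

theorem fischerForm_self_eq_zero {f : MvPolynomial σ 𝕜} : fischerForm f f = 0 ↔ f = 0 := by
  refine ⟨fun hf => ?_, by rintro rfl; simp⟩
  have hpos (α : σ →₀ ℕ) : (0 : ℝ) < α.prod fun _ k => (k ! : ℝ) :=
    Finset.prod_pos fun i _ => by positivity
  rw [fischerForm_self, RCLike.ofReal_eq_zero,
    Finset.sum_eq_zero_iff_of_nonneg fun α _ => by have := hpos α; positivity] at hf
  ext α
  by_contra hα
  have := hf α (mem_support_iff.mpr hα)
  simp_all [(hpos α).ne']

/-- The Fischer form as an inner product; it is kept out of the instances. -/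
noncomputable abbrev fischerCore (𝕜 σ : Type*) [RCLike 𝕜] :
    InnerProductSpace.Core 𝕜 (MvPolynomial σ 𝕜) where
  inner f g := fischerForm f g
  conj_inner_symm := conj_fischerForm
  re_inner_nonneg f := by
    rw [fischerForm_self, RCLike.ofReal_re]
    exact Finset.sum_nonneg fun α _ =>
      mul_nonneg (Finset.prod_nonneg fun i _ => Nat.cast_nonneg _) (sq_nonneg _)
  add_left f g h := by rw [map_add, LinearMap.add_apply]
  smul_left f g a := by rw [map_smulₛₗ, LinearMap.smul_apply, smul_eq_mul]
  definite _ := fischerForm_self_eq_zero.mp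

theorem exists_add_fischerForm_eq_zero (U : Submodule 𝕜 (MvPolynomial σ 𝕜))
    [FiniteDimensional 𝕜 U] (f : MvPolynomial σ 𝕜) :
    ∃ u ∈ U, ∃ g, (∀ v ∈ U, fischerForm v g = 0) ∧ f = u + g := by
  let _ : NormedAddCommGroup (MvPolynomial σ 𝕜) := (fischerCore 𝕜 σ).toNormedAddCommGroup
  let _ : InnerProductSpace 𝕜 (MvPolynomial σ 𝕜) := .ofCore (fischerCore 𝕜 σ).toCore
  exact U.exists_add_mem_mem_orthogonal f

theorem finiteDimensional_substSpan {K τ : Type*} [Field K] [Fintype τ] (T : Set (Matrix σ τ K))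
    (f : MvPolynomial σ K) : FiniteDimensional K (substSpan T f) := by
  refine Submodule.finiteDimensional_of_le (S₂ := restrictTotalDegree τ K f.totalDegree) ?_
  refine Submodule.span_le.mpr ?_
  rintro _ ⟨S, -, rfl⟩
  exact (mem_restrictTotalDegree _ _ _).mpr (totalDegree_linSubst_le S f)

theorem mem_substSpan [Fintype σ] {T : Subsemigroup (Matrix σ σ 𝕜)} (hT : ∀ S ∈ T, Sᴴ ∈ T)
    (hsurj : ∀ x : σ → 𝕜, ∃ S ∈ T, ∃ y, S *ᵥ y = x) (f : MvPolynomial σ 𝕜) :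
    f ∈ substSpan (T : Set (Matrix σ σ 𝕜)) f := by
  have := finiteDimensional_substSpan (T : Set (Matrix σ σ 𝕜)) f
  obtain ⟨u, hu, g, hg, hf⟩ := exists_add_fischerForm_eq_zero (substSpan (T : Set _) f) f
  have hkill : ∀ S ∈ T, linSubst S g = 0 := by
    intro S hS
    have hmem : linSubst S g ∈ substSpan (T : Set (Matrix σ σ 𝕜)) f := by
      rw [eq_sub_of_add_eq' hf.symm, map_sub]
      exact Submodule.sub_mem _ (linSubst_mem_substSpan hS f) (linSubst_mem_substSpan_of_mem hS hu)
    have horth : fischerForm (linSubst Sᴴ (linSubst S g)) g = 0 :=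
      hg _ (linSubst_mem_substSpan_of_mem (hT S hS) hmem)
    rwa [fischerForm_linSubst_left, conjTranspose_conjTranspose, fischerForm_self_eq_zero] at horth
  have hg0 : g = 0 := MvPolynomial.funext fun x => by
    obtain ⟨S, hS, y, rfl⟩ := hsurj x
    rw [← eval_linSubst, hkill S hS, map_zero, map_zero]
  rw [hg0, add_zero] at hf
  rwa [← hf] at hu

end Orbit

section Polarization

variable {R : Type*} [CommSemiring R] {ι κ μ q : Type*}

theorem exists_mul_eq_one_of_card_le [Fintype ι] [DecidableEq ι] [Fintype κ]
    (h : Fintype.card ι ≤ Fintype.card κ) :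
    ∃ (P : Matrix ι κ R) (Q : Matrix κ ι R), P * Q = 1 := by
  classical
  obtain ⟨e⟩ := Function.Embedding.nonempty_of_card_le h
  refine ⟨(1 : Matrix κ κ R).submatrix e id, (1 : Matrix κ κ R).submatrix id e, ?_⟩
  rw [← submatrix_mul _ _ _ _ _ Function.bijective_id, mul_one, submatrix_one e e.injective]

theorem exists_mul_mul_eq [Fintype ι] [Fintype κ] [Fintype q]
    (h : min (Fintype.card ι) (Fintype.card q) ≤ Fintype.card κ) (A : Matrix ι q R) :
    ∃ (P : Matrix ι κ R) (Q : Matrix κ ι R) (B : Matrix ι q R), P * Q * B = A := by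
  classical
  by_cases hι : Fintype.card ι ≤ Fintype.card κ
  · obtain ⟨P, Q, hPQ⟩ := exists_mul_eq_one_of_card_le (R := R) hι
    exact ⟨P, Q, A, by rw [hPQ, Matrix.one_mul]⟩
  · have hq : Fintype.card q ≤ Fintype.card κ := (min_le_iff.mp h).resolve_left hι
    obtain ⟨E, F, hEF⟩ := exists_mul_eq_one_of_card_le (R := R) hq
    obtain ⟨Q, B, hQB⟩ := exists_mul_eq_one_of_card_le (R := R) (not_le.mp hι).le
    refine ⟨A * E, Q, B * F, ?_⟩
    rw [Matrix.mul_assoc, ← Matrix.mul_assoc Q, hQB, Matrix.one_mul, Matrix.mul_assoc, hEF,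
      Matrix.mul_one]

variable [Fintype κ] [Fintype μ] [Fintype q] [DecidableEq q]

theorem kronecker_one_mulVec_apply (P : Matrix ι κ R) (x : κ × q → R) (i : ι) (j : q) :
    ((P ⊗ₖ (1 : Matrix q q R)) *ᵥ x) (i, j) = ∑ k, P i k * x (k, j) := by
  simp [mulVec, dotProduct, Fintype.sum_prod_type, one_apply]

/-- The substitution `x_(i, j) ↦ ∑ k, P i k * x_(k, j)`. With the variables `x_(i, ·)` read as the
coordinates of the `i`-th of `ι` vectors, it replaces these by combinations of `κ` vectors. -/
noncomputable def blockSubst (q : Type*) [Fintype q] [DecidableEq q] (P : Matrix ι κ R) :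
    MvPolynomial (ι × q) R →ₐ[R] MvPolynomial (κ × q) R :=
  linSubst (P ⊗ₖ (1 : Matrix q q R))

theorem blockSubst_blockSubst (P : Matrix ι κ R) (Q : Matrix κ μ R)
    (f : MvPolynomial (ι × q) R) :
    blockSubst q Q (blockSubst q P f) = blockSubst q (P * Q) f := by
  rw [blockSubst, blockSubst, linSubst_linSubst, ← mul_kronecker_mul, Matrix.one_mul, blockSubst]

/-- The semigroup of the operators on `ι`-tuples of vectors that factor through `κ`-tuples. -/
def factoringSemigroup (R ι κ q : Type*) [CommSemiring R] [Fintype ι] [Fintype κ] [Fintype q]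
    [DecidableEq q] : Subsemigroup (Matrix (ι × q) (ι × q) R) where
  carrier := {S | ∃ (P : Matrix ι κ R) (Q : Matrix κ ι R), (P * Q) ⊗ₖ (1 : Matrix q q R) = S}
  mul_mem' := by
    rintro _ _ ⟨P, Q, rfl⟩ ⟨P', Q', rfl⟩
    exact ⟨P, Q * (P' * Q'), by
      rw [← mul_kronecker_mul, Matrix.one_mul, Matrix.mul_assoc P Q (P' * Q')]⟩

/-- **Weyl's polarization theorem** for tuples of vectors of dimension `card q`. -/
theorem mem_span_blockSubst {𝕜 : Type*} [RCLike 𝕜] [Fintype ι]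
    (h : min (Fintype.card ι) (Fintype.card q) ≤ Fintype.card κ) (f : MvPolynomial (ι × q) 𝕜) :
    f ∈ Submodule.span 𝕜 {g | ∃ (P : Matrix ι κ 𝕜) (Q : Matrix κ ι 𝕜),
      blockSubst q Q (blockSubst q P f) = g} := by
  have hstar : ∀ S ∈ factoringSemigroup 𝕜 ι κ q, Sᴴ ∈ factoringSemigroup 𝕜 ι κ q := by
    rintro _ ⟨P, Q, rfl⟩
    exact ⟨Qᴴ, Pᴴ, by rw [conjTranspose_kronecker, conjTranspose_mul, conjTranspose_one]⟩
  have hsurj (x : ι × q → 𝕜) : ∃ S ∈ factoringSemigroup 𝕜 ι κ q, ∃ y, S *ᵥ y = x := by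
    obtain ⟨P, Q, B, hB⟩ := exists_mul_mul_eq h (Matrix.of (Function.curry x))
    refine ⟨_, ⟨P, Q, rfl⟩, Function.uncurry B, funext fun ⟨i, j⟩ => ?_⟩
    rw [kronecker_one_mulVec_apply]
    exact congrFun₂ hB i j
  refine Submodule.span_mono ?_ (mem_substSpan hstar hsurj f)
  rintro _ ⟨_, ⟨P, Q, rfl⟩, rfl⟩
  exact ⟨P, Q, blockSubst_blockSubst P Q f⟩

end Polarization

section SingIdeal

theorem det_sum_smul_eq_zero_of_infinite {R ι ν : Type*} [CommRing R] [IsDomain R] [Fintype ι]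
    [Fintype ν] [DecidableEq ν] {s : Set R} (hs : s.Infinite) {A : ι → Matrix ν ν R}
    (hA : ∀ c : ι → R, (∀ k, c k ∈ s) → (∑ k, c k • A k).det = 0) (c : ι → R) :
    (∑ k, c k • A k).det = 0 := by
  let M : Matrix ν ν (MvPolynomial ι R) := ∑ k, (X k : MvPolynomial ι R) • (A k).map C
  have hM (c : ι → R) : eval c M.det = (∑ k, c k • A k).det := by
    rw [RingHom.map_det]
    congr 1
    ext i j
    simp [M, Matrix.sum_apply]
  have hdet : M.det = 0 := funext_set (fun _ => s) (fun _ => hs) fun x hx => by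
    rw [hM, map_zero, hA x fun k => hx k (Set.mem_univ k)]
  rw [← hM, hdet, map_zero]

variable {n m m' d : ℕ}

theorem det_sum_smul_eq_zero {A : Fin m → Matrix (Fin n) (Fin n) ℂ} (hA : A ∈ Sing n m)
    (c : Fin m → ℂ) : (∑ k, c k • A k).det = 0 := by
  refine det_sum_smul_eq_zero_of_infinite
    (Set.infinite_range_of_injective (Rat.cast_injective (α := ℂ))) (fun c hc => ?_) c
  choose r hr using hc
  simpa only [hr] using hA r

theorem sum_smul_mem_Sing {A : Fin m → Matrix (Fin n) (Fin n) ℂ} (hA : A ∈ Sing n m)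
    (P : Matrix (Fin m') (Fin m) ℂ) : (fun k => ∑ l, P k l • A l) ∈ Sing n m' := by
  intro c
  rw [← det_sum_smul_eq_zero hA fun l => ∑ k, (c k : ℂ) * P k l]
  simp only [Finset.smul_sum, Finset.sum_smul, mul_smul]
  rw [Finset.sum_comm]

theorem slices_kronecker_one_mulVec (P : Matrix (Fin m') (Fin m) ℂ) (x : TensorIndex n m → ℂ) :
    slices ((P ⊗ₖ (1 : Matrix (Fin n × Fin n) (Fin n × Fin n) ℂ)) *ᵥ x) =
      fun k => ∑ l, P k l • slices x l := by
  ext k i j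
  simp [slices, kronecker_one_mulVec_apply, Matrix.sum_apply]

theorem blockSubst_mem_singIdeal (P : Matrix (Fin m) (Fin m') ℂ)
    {f : MvPolynomial (TensorIndex n m) ℂ} (hf : f ∈ singIdeal n m) :
    blockSubst (Fin n × Fin n) P f ∈ singIdeal n m' := by
  simp only [singIdeal, mem_vanishingIdeal_iff, aeval_eq_eval] at hf ⊢
  intro x hx
  refine (eval_linSubst _ _ _).trans (hf _ ?_)
  rw [Set.mem_ofPred_eq, slices_kronecker_one_mulVec]
  exact sum_smul_mem_Sing hx P

end SingIdeal

section LowDegreeIdeal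

/-- The ideal generated by the homogeneous elements of degree at most `d` of `I`. -/
noncomputable def lowDegreeIdeal {σ R : Type*} [CommSemiring R] (I : Ideal (MvPolynomial σ R))
    (d : ℕ) : Ideal (MvPolynomial σ R) :=
  Ideal.span {f | f ∈ I ∧ ∃ e ≤ d, f.IsHomogeneous e}

theorem lowDegreeIdeal_le {σ R : Type*} [CommSemiring R] (I : Ideal (MvPolynomial σ R)) (d : ℕ) :
    lowDegreeIdeal I d ≤ I :=
  Ideal.span_le.mpr fun _ h => h.1

theorem linSubst_mem_lowDegreeIdeal {σ τ R : Type*} [CommSemiring R] [Fintype τ]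
    {I : Ideal (MvPolynomial σ R)} {J : Ideal (MvPolynomial τ R)} {S : Matrix σ τ R}
    (hS : ∀ f ∈ I, linSubst S f ∈ J) {d : ℕ} {f : MvPolynomial σ R}
    (hf : f ∈ lowDegreeIdeal I d) : linSubst S f ∈ lowDegreeIdeal J d := by
  suffices h : lowDegreeIdeal I d ≤ (lowDegreeIdeal J d).comap (linSubst S) from h hf
  refine Ideal.span_le.mpr ?_
  rintro g ⟨hg, e, he, hhom⟩
  exact Ideal.subset_span ⟨hS g hg, e, he, isHomogeneous_linSubst S hhom⟩

end LowDegreeIdeal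

theorem IsGeneratedInDegreeLE.singIdeal_of_min_le {n m m' d : ℕ}
    (h : IsGeneratedInDegreeLE (singIdeal n m') d) (hm : min m (n ^ 2) ≤ m') :
    IsGeneratedInDegreeLE (singIdeal n m) d := by
  have hlow : lowDegreeIdeal (singIdeal n m') d = singIdeal n m' := h
  refine (lowDegreeIdeal_le (singIdeal n m) d).antisymm fun f hf => ?_
  have hcard : min (Fintype.card (Fin m)) (Fintype.card (Fin n × Fin n)) ≤
      Fintype.card (Fin m') := by
    simpa only [Fintype.card_prod, Fintype.card_fin, ← sq] using hm
  suffices hle : Submodule.span ℂ _ ≤ (lowDegreeIdeal (singIdeal n m) d).restrictScalars ℂ from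
    hle (mem_span_blockSubst hcard f)
  rw [Submodule.span_le]
  rintro _ ⟨P, Q, rfl⟩
  have hP : blockSubst _ P f ∈ lowDegreeIdeal (singIdeal n m') d :=
    hlow.ge (blockSubst_mem_singIdeal P hf)
  exact linSubst_mem_lowDegreeIdeal (fun _ => blockSubst_mem_singIdeal Q) hP

theorem corollary4p5 (n d : ℕ) :
    ((∀ m : ℕ, IsGeneratedInDegreeLE (singIdeal n m) d) ↔
      IsGeneratedInDegreeLE (singIdeal n (n ^ 2)) d) ∧
    (∀ m : ℕ, n ^ 2 ≤ m →
      (IsGeneratedInDegreeLE (singIdeal n m) d ↔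
        IsGeneratedInDegreeLE (singIdeal n (n ^ 2)) d)) := by
  refine ⟨⟨fun h => h (n ^ 2), fun h m => ?_⟩, fun m hm => ⟨fun h => ?_, fun h => ?_⟩⟩
  · exact h.singIdeal_of_min_le (min_le_right m (n ^ 2))
  · exact h.singIdeal_of_min_le ((min_le_left _ _).trans hm)
  · exact h.singIdeal_of_min_le (min_le_right m (n ^ 2))
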